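/- Let $A\in\mathbb H^{n\times n}$ be a Hermitian matrix over the real quaternions, let $k=\operatorname{Ind}A$ be the least integer $k\ge 0$ with $\operatorname{rank}A^{k+1}=\operatorname{rank}A^{k}$, where the rank is the maximal number of right linearly independent columns, and let $r=\operatorname{rank}A^{k+1}=\operatorname{rank}A^{k}$. Let $A^D$ be the Drazin inverse of $A$, i.e. the unique matrix $X$ with $A^{k+1}X=A^{k}$, $XAX=X$ and $AX=XA$. For a quaternion matrix $M$ with rows and columns indexed by a finite set of integers, and a permutation $\sigma$ of that set, write $M_\sigma(x)=m_{x\,\sigma(x)}\,m_{\sigma(x)\,\sigma^2(x)}\cdots m_{\sigma^{l}(x)\,x}$ for the product along the cycle $(x,\sigma(x),\dots,\sigma^{l}(x))$ of $\sigma$ that starts at $x$ ($M_\sigma(x)=m_{xx}$ if $\sigma(x)=x$). For an index $i$, let $x_2<\dots<x_p$ be the smallest elements of the cycles of $\sigma$ (fixed points included) that do not contain $i$. The $i$th row and column determinants are $$\operatorname{rdet}_i M=\sum_{\sigma}\operatorname{sgn}(\sigma)\,M_\sigma(i)\,M_\sigma(x_2)\cdots M_\sigma(x_p),\qquad \operatorname{cdet}_i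 M=\sum_{\sigma}\operatorname{sgn}(\sigma)\,M_\sigma(x_p)\cdots M_\sigma(x_2)\,M_\sigma(i).$$ If $M$ is Hermitian, all its row and column determinants have one common real value, denoted $|M|$ (with $|M|=1$ for the empty matrix). For $\beta\subseteq\{1,\dots,n\}$ let $M_\beta^\beta$ be the principal submatrix with rows and columns in $\beta$. Let $J_{r,n}$ be the set of all $r$-element subsets of $\{1,\dots,n\}$ and $J_{r,n}\{i\}$ the set of those that contain $i$. Let $M_{.i}(b)$ (respectively $M_{i.}(b)$) be $M$ with its $i$th column (respectively row) replaced by $b$, and let $a^{(m)}_{.j}$ and $a^{(m)}_{i.}$ be the $j$th column and the $i$th row of $A^m$. Then $\sum_{\beta\in J_{r,n}}\left|(A^{k+1})_\beta^\beta\right|\neq 0$ and, for all $1\le i,j\le n$, $$(A^DA)_{ij}=\frac{\sum_{\beta\in J_{r,n}\{i\}}\operatorname{cdet}_i\left(\left((A^{k+1})_{.i}\left(a^{(k+1)}_{.j}\right)\right)_\beta^\beta\right)}{\sum_{\beta\in J_{r,n}}\left|(A^{k+1})_\beta^\beta\right|},\qquad (AA^D)_{ij}=\frac{\sum_{\alpha\in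 J_{r,n}\{j\}}\operatorname{rdet}_j\left(\left((A^{k+1})_{j.}\left(a^{(k+1)}_{i.}\right)\right)_\alpha^\alpha\right)}{\sum_{\alpha\in J_{r,n}}\left|(A^{k+1})_\alpha^\alpha\right|}.$$ -/

import Mathlib

open scoped Matrix

noncomputable section

namespace QuatDrazin

/-! ### Row and column determinants of a quaternion matrix

The index type `ι` is any finite linearly ordered type, so that the definitions apply to a matrix
indexed by `Fin n` and to its principal submatrices alike. -/

section Determinants

variable {ι : Type*} [Fintype ι] [LinearOrder ι]

/-- The product `a_{x, σ x} a_{σ x, σ² x} ⋯ a_{σ^l x, x}` along the whole cycle of `σ` that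
starts (and ends) at `x`; for a fixed point `x` it is `a_{x, x}`. -/
def cycleProd (A : Matrix ι ι (Quaternion ℝ)) (σ : Equiv.Perm ι) (x : ι) : Quaternion ℝ :=
  ((List.range (Function.minimalPeriod σ x)).map
    fun m => A ((σ ^ m) x) ((σ ^ (m + 1)) x)).prod

/-- The opening elements of the cycles of `σ` (fixed points count as cycles) in the ordered cycle
notation: first `i`, which opens its own cycle, then in increasing order the smallest elements of
the cycles that do not contain `i`. -/
def cycleOpeners (σ : Equiv.Perm ι) (i : ι) : List ι :=
  open Classical in
  i :: (Finset.univ.filter fun x : ι =>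
    ¬ σ.SameCycle i x ∧ ∀ y, σ.SameCycle x y → x ≤ y).sort (· ≤ ·)

/-- The `i`th row determinant: the cycles of the left-ordered cycle notation are multiplied from
left to right, the cycle of `i` first. The sign `(-1) ^ (n - r)`, where `r` is the number of cycles
of `σ`, is the sign of `σ`. -/
def rdet (i : ι) (A : Matrix ι ι (Quaternion ℝ)) : Quaternion ℝ :=
  ∑ σ : Equiv.Perm ι,
    ((Equiv.Perm.sign σ : ℤ) : Quaternion ℝ) * ((cycleOpeners σ i).map (cycleProd A σ)).prod

/-- The `j`th column determinant: the cycles of the right-ordered cycle notation are multiplied in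
the opposite order, the cycle of `j` being the rightmost one. Each cycle, read from the right,
starts at the column index of its opening element `x`, so that its product is
`a_{x, τ x} ⋯ a_{τ⁻² x, τ⁻¹ x} a_{τ⁻¹ x, x}`. -/
def cdet (j : ι) (A : Matrix ι ι (Quaternion ℝ)) : Quaternion ℝ :=
  ∑ τ : Equiv.Perm ι,
    ((Equiv.Perm.sign τ : ℤ) : Quaternion ℝ) *
      ((cycleOpeners τ j).reverse.map (cycleProd A τ)).prod

/-- `d` is the common real value of all row and column determinants of `A`
(and `d = 1` for the empty matrix). -/
def IsCommonDet (A : Matrix ι ι (Quaternion ℝ)) (d : ℝ) : Prop :=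
  (∀ i, rdet i A = (d : Quaternion ℝ) ∧ cdet i A = (d : Quaternion ℝ)) ∧ (IsEmpty ι → d = 1)

/-- The determinant of a Hermitian matrix: the common real value of all its row and column
determinants. (The default value `0` is for matrices without such a common value; Hermitian
matrices always have one.) -/
def hdet (A : Matrix ι ι (Quaternion ℝ)) : ℝ :=
  open Classical in if h : ∃ d, IsCommonDet A d then h.choose else 0

theorem hdet_eq {A : Matrix ι ι (Quaternion ℝ)} {d : ℝ} (h : IsCommonDet A d) : hdet A = d := by
  have h' : ∃ d, IsCommonDet A d := ⟨d, h⟩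
  have hc : hdet A = h'.choose := dif_pos h'
  have hs := h'.choose_spec
  rw [hc]
  rcases isEmpty_or_nonempty ι with hι | ⟨⟨i⟩⟩
  · rw [hs.2 hι, h.2 hι]
  · exact Quaternion.coe_injective ((hs.1 i).1.symm.trans (h.1 i).1)

/-- The principal submatrix of `M` with rows and columns indexed by `β`. -/
def principal (M : Matrix ι ι (Quaternion ℝ)) (β : Finset ι) : Matrix β β (Quaternion ℝ) :=
  M.submatrix Subtype.val Subtype.val

/-- `∑_{β ∈ J_{r,n}} |M_β^β|`, the sum of the principal minors of order `r` of a Hermitian `M`. -/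
def minorSum (r : ℕ) (M : Matrix ι ι (Quaternion ℝ)) : ℝ :=
  ∑ β ∈ Finset.univ.powersetCard r, hdet (principal M β)

/-- `∑_{β ∈ J_{r,n}{i}} cdet_i (M_β^β)`, over the `r`-element index sets `β` that contain `i`. -/
def cdetSum (r : ℕ) (i : ι) (M : Matrix ι ι (Quaternion ℝ)) : Quaternion ℝ :=
  ∑ β : {β : Finset ι // β.card = r ∧ i ∈ β}, cdet ⟨i, β.2.2⟩ (principal M β.1)

/-- `∑_{α ∈ I_{r,n}{j}} rdet_j (M_α^α)`, over the `r`-element index sets `α` that contain `j`. -/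
def rdetSum (r : ℕ) (j : ι) (M : Matrix ι ι (Quaternion ℝ)) : Quaternion ℝ :=
  ∑ α : {α : Finset ι // α.card = r ∧ j ∈ α}, rdet ⟨j, α.2.2⟩ (principal M α.1)

end Determinants

/-! ### Rank, index and Drazin inverse -/

section Drazin

variable {ι : Type*} [Fintype ι]

/-- The right linear span of the columns of `A`. -/
def colSpace (A : Matrix ι ι (Quaternion ℝ)) :
    Submodule (Quaternion ℝ)ᵐᵒᵖ (ι → Quaternion ℝ) :=
  Submodule.span (Quaternion ℝ)ᵐᵒᵖ (Set.range A.col)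

/-- The rank of a quaternion matrix: the maximal number of right linearly independent columns. -/
def qrank (A : Matrix ι ι (Quaternion ℝ)) : ℕ :=
  Module.finrank (Quaternion ℝ)ᵐᵒᵖ (colSpace A)

theorem colSpace_le_iff {A B : Matrix ι ι (Quaternion ℝ)} :
    colSpace A ≤ colSpace B ↔ ∃ Z, A = B * Z := by
  have key : ∀ (c : ι → (Quaternion ℝ)ᵐᵒᵖ) (i : ι),
      (∑ s, c s • B.col s) i = ∑ s, B i s * (c s).unop := by
    intro c i
    simp [Finset.sum_apply, Matrix.col]
  constructor
  · intro h
    have hcol : ∀ j, ∃ c : ι → (Quaternion ℝ)ᵐᵒᵖ, ∑ s, c s • B.col s = A.col j := fun j =>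
      (Submodule.mem_span_range_iff_exists_fun _).1 (h (Submodule.subset_span ⟨j, rfl⟩))
    choose c hc using hcol
    refine ⟨Matrix.of fun s j => (c j s).unop, ?_⟩
    ext1 i j
    rw [Matrix.mul_apply, show A i j = A.col j i from rfl, ← hc, key]
    rfl
  · rintro ⟨Z, rfl⟩
    refine Submodule.span_le.2 ?_
    rintro _ ⟨j, rfl⟩
    refine (Submodule.mem_span_range_iff_exists_fun _).2 ⟨fun s => MulOpposite.op (Z s j), ?_⟩
    funext i
    rw [key]
    rfl

variable [DecidableEq ι]

/-- The index of `A`: the least `k` with `rank A^(k+1) = rank A^k`. -/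
def index (A : Matrix ι ι (Quaternion ℝ)) : ℕ :=
  sInf {k : ℕ | qrank (A ^ (k + 1)) = qrank (A ^ k)}

/-- The defining equations of the Drazin inverse `X` of `A`. -/
structure IsDrazinInverse (A X : Matrix ι ι (Quaternion ℝ)) : Prop where
  pow_mul : A ^ (index A + 1) * X = A ^ index A
  mul_mul : X * A * X = X
  comm : A * X = X * A

theorem colSpace_pow_succ_le (A : Matrix ι ι (Quaternion ℝ)) (m : ℕ) :
    colSpace (A ^ (m + 1)) ≤ colSpace (A ^ m) :=
  colSpace_le_iff.2 ⟨A, pow_succ A m⟩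

instance finite_colSpace (A : Matrix ι ι (Quaternion ℝ)) :
    Module.Finite (Quaternion ℝ)ᵐᵒᵖ (colSpace A) :=
  FiniteDimensional.span_of_finite _ (Set.finite_range _)

/-- The set whose minimum is the index is not empty. -/
theorem index_spec (A : Matrix ι ι (Quaternion ℝ)) :
    qrank (A ^ (index A + 1)) = qrank (A ^ index A) := by
  refine Nat.sInf_mem (s := {k : ℕ | qrank (A ^ (k + 1)) = qrank (A ^ k)}) ?_
  by_contra hne
  have hlt : ∀ k, qrank (A ^ (k + 1)) < qrank (A ^ k) := fun k =>
    lt_of_le_of_ne (Submodule.finrank_mono (colSpace_pow_succ_le A k)) fun h => hne ⟨k, h⟩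
  have hle : ∀ k, qrank (A ^ k) + k ≤ qrank (A ^ 0) := by
    intro k
    induction k with
    | zero => simp
    | succ k ih => have := hlt k; omega
  have := hle (qrank (A ^ 0) + 1)
  omega

theorem exists_pow_eq (A : Matrix ι ι (Quaternion ℝ)) (m : ℕ) :
    ∃ W, A ^ index A = A ^ (index A + m) * W := by
  induction m with
  | zero => exact ⟨1, by simp⟩
  | succ m ih =>
    obtain ⟨W, hW⟩ := ih
    obtain ⟨Z, hZ⟩ := colSpace_le_iff.1
      (Submodule.eq_of_le_of_finrank_eq (colSpace_pow_succ_le A (index A)) (index_spec A)).ge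
    refine ⟨Z * W, ?_⟩
    calc A ^ index A = A ^ m * A ^ index A * W := by rw [← pow_add, add_comm m, ← hW]
      _ = A ^ m * (A ^ (index A + 1) * Z) * W := by rw [← hZ]
      _ = A ^ (index A + (m + 1)) * (Z * W) := by
        rw [← mul_assoc, ← pow_add, mul_assoc]
        congr 2
        omega

theorem exists_pow_eq_pow_succ_mul (A : Matrix ι ι (Quaternion ℝ)) :
    ∃ (m : ℕ) (G : Matrix ι ι (Quaternion ℝ)), Commute A G ∧ A ^ m = A ^ (m + 1) * G := by
  have hint : IsIntegral ℝ A := Algebra.IsIntegral.isIntegral A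
  obtain ⟨q, hq, hnd⟩ := (minpoly ℝ A).exists_eq_pow_rootMultiplicity_mul_and_not_dvd
    (minpoly.ne_zero hint) 0
  set m := (minpoly ℝ A).rootMultiplicity 0
  have hc : q.coeff 0 ≠ 0 := by
    simpa [Polynomial.X_dvd_iff] using hnd
  have h0 : A ^ m * Polynomial.aeval A q = 0 := by
    have h1 := minpoly.aeval ℝ A
    rw [hq] at h1
    simpa using h1
  have hq' : Polynomial.aeval A q
      = A * Polynomial.aeval A q.divX + algebraMap ℝ _ (q.coeff 0) := by
    conv_lhs => rw [← Polynomial.X_mul_divX_add q]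
    rw [map_add, map_mul, Polynomial.aeval_X, Polynomial.aeval_C]
  have hcomm : Commute A (Polynomial.aeval A q.divX) := by
    have h := (Commute.all (Polynomial.X : Polynomial ℝ) q.divX).map (Polynomial.aeval A)
    rwa [Polynomial.aeval_X] at h
  refine ⟨m, -(q.coeff 0)⁻¹ • Polynomial.aeval A q.divX, hcomm.smul_right _, ?_⟩
  rw [hq', mul_add, ← mul_assoc, ← pow_succ, Algebra.algebraMap_eq_smul_one, mul_smul_comm,
    mul_one] at h0
  rw [mul_smul_comm, eq_neg_of_add_eq_zero_left h0, smul_neg, neg_smul, neg_neg, smul_smul,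
    inv_mul_cancel₀ hc, one_smul]

theorem exists_isDrazinInverse (A : Matrix ι ι (Quaternion ℝ)) :
    ∃ X, IsDrazinInverse A X := by
  obtain ⟨m, G, hG, hm⟩ := exists_pow_eq_pow_succ_mul A
  obtain ⟨W, hW⟩ := exists_pow_eq A m
  have hmj : ∀ j, A ^ m = A ^ (m + j) * G ^ j := by
    intro j
    induction j with
    | zero => simp
    | succ j ih =>
      calc A ^ m = A ^ j * A ^ m * G ^ j := by rw [← pow_add, add_comm j, ← ih]
        _ = A ^ j * (A ^ (m + 1) * G) * G ^ j := by rw [← hm]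
        _ = A ^ (m + (j + 1)) * G ^ (j + 1) := by
          rw [← mul_assoc, ← pow_add, mul_assoc, ← pow_succ', show j + (m + 1) = m + (j + 1) by ring]
  have hX : Commute A (A ^ m * G ^ (m + 1)) :=
    ((Commute.refl A).pow_right m).mul_right (hG.pow_right (m + 1))
  have hproj : A ^ (m + 1) * (A ^ m * G ^ (m + 1)) = A ^ m := by
    rw [← mul_assoc, ← pow_add, show m + 1 + m = m + (m + 1) by ring]
    exact (hmj (m + 1)).symm
  refine ⟨A ^ m * G ^ (m + 1), ⟨?_, ?_, hX.eq⟩⟩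
  · have hp : Commute (A ^ (m + 1)) (A ^ m * G ^ (m + 1)) := hX.pow_left (m + 1)
    calc A ^ (index A + 1) * (A ^ m * G ^ (m + 1))
        = (A ^ m * G ^ (m + 1)) * A ^ (index A + 1) := (hX.pow_left (index A + 1)).eq
      _ = (A ^ m * G ^ (m + 1)) * (A * (A ^ (index A + m) * W)) := by
        rw [← hW, pow_succ' A (index A)]
      _ = (A ^ m * G ^ (m + 1)) * A ^ (m + 1) * (A ^ index A * W) := by
        rw [← mul_assoc A, ← pow_succ', show index A + m + 1 = m + 1 + index A by ring,
          pow_add A (m + 1) (index A), mul_assoc (A ^ (m + 1)), ← mul_assoc _ (A ^ (m + 1))]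
      _ = A ^ m * (A ^ index A * W) := by rw [← hp.eq, hproj]
      _ = A ^ index A := by rw [← mul_assoc, ← pow_add, add_comm m, ← hW]
  · calc A ^ m * G ^ (m + 1) * A * (A ^ m * G ^ (m + 1))
        = A * (A ^ m * G ^ (m + 1)) * (A ^ m * G ^ (m + 1)) := by rw [hX.eq]
      _ = A ^ (m + 1) * (G ^ (m + 1) * A ^ m) * G ^ (m + 1) := by
        rw [pow_succ' A m]
        simp only [mul_assoc]
      _ = A ^ (m + 1) * (A ^ m * G ^ (m + 1)) * G ^ (m + 1) := by
        rw [(hG.pow_pow m (m + 1)).eq]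
      _ = A ^ m * G ^ (m + 1) := by rw [hproj]

theorem IsDrazinInverse.eq_pow_mul_pow {A X : Matrix ι ι (Quaternion ℝ)}
    (h : IsDrazinInverse A X) (j : ℕ) : A ^ j * X ^ (j + 1) = X := by
  induction j with
  | zero => simp
  | succ j ih =>
    calc A ^ (j + 1) * X ^ (j + 1 + 1) = A * (A ^ j * X ^ (j + 1)) * X := by
          rw [pow_succ' A j, pow_succ X (j + 1)]
          simp only [mul_assoc]
      _ = X := by rw [ih, h.comm, h.mul_mul]

theorem IsDrazinInverse.unique {A X Y : Matrix ι ι (Quaternion ℝ)}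
    (hX : IsDrazinInverse A X) (hY : IsDrazinInverse A Y) : X = Y := by
  have cX : Commute A X := hX.comm
  have cY : Commute A Y := hY.comm
  have h1 : X = Y * A * X := by
    calc X = A ^ index A * X ^ (index A + 1) := (hX.eq_pow_mul_pow _).symm
      _ = Y * A ^ (index A + 1) * X ^ (index A + 1) := by
        rw [← (cY.pow_left (index A + 1)).eq, hY.pow_mul]
      _ = Y * A * (A ^ index A * X ^ (index A + 1)) := by
        rw [pow_succ' A (index A)]
        simp only [mul_assoc]
      _ = Y * A * X := by rw [hX.eq_pow_mul_pow]
  have h2 : Y = Y * A * X := by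
    have h3 : Y ^ (index A + 1) * A ^ index A = Y := by
      rw [← (cY.pow_pow (index A) (index A + 1)).eq, hY.eq_pow_mul_pow]
    calc Y = Y ^ (index A + 1) * A ^ index A := h3.symm
      _ = Y ^ (index A + 1) * (A ^ (index A + 1) * X) := by rw [hX.pow_mul]
      _ = Y ^ (index A + 1) * A ^ index A * A * X := by
        rw [pow_succ A (index A)]
        simp only [mul_assoc]
      _ = Y * A * X := by rw [h3]
  rw [h1, ← h2]

/-- Every square quaternion matrix has exactly one Drazin inverse. -/
theorem existsUnique_isDrazinInverse (A : Matrix ι ι (Quaternion ℝ)) :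
    ∃! X, IsDrazinInverse A X :=
  let ⟨X, hX⟩ := exists_isDrazinInverse A
  ⟨X, hX, fun _ hY => hY.unique hX⟩

/-- The Drazin inverse `A^D` of `A`. -/
def drazin (A : Matrix ι ι (Quaternion ℝ)) : Matrix ι ι (Quaternion ℝ) :=
  (existsUnique_isDrazinInverse A).exists.choose

theorem drazin_spec (A : Matrix ι ι (Quaternion ℝ)) : IsDrazinInverse A (drazin A) :=
  (existsUnique_isDrazinInverse A).exists.choose_spec

end Drazin

end QuatDrazin

end

/-!
Let `M = A ^ (k + 1)`, a Hermitian matrix, and let `P = A^D A`, which is idempotent, satisfies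
`P M = M`, has the rank of `A ^ k`, and is a multiple of `M` by a matrix that commutes with `M`.

*Determinants.* In the column determinant along column `i`, the entry `b l` of a column `b` that
replaces the `i`th column of `M` stands last in the cycle of `i`. Removing `l` from this cycle gives
a Laplace expansion (`colSum_updateCol`) whose coefficients, the cofactors, are again column
determinants of smaller principal submatrices. So the cofactors satisfy a recursion that splits off
the last factor, which turns out to be equivalent to one that splits off the first factor
(`cofactor_eq_sum_left`). Conjugation exchanges the two recursions, whence the cofactor matrix of a
Hermitian matrix is Hermitian (`star_cofactor`). This is first done with the products along the
cycles that avoid `i` replaced by their real parts, so that the order of the cycles does not matter.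
There the column determinant is real by the symmetry of the cofactors, and its real part does not
depend on the column, because the real part of a cycle product does not depend on the starting point
(`sum_cofactor_mul_self`). Cramer's rule `sum_cofactor_mul` follows from the first-factor recursion
by induction on the index set. As both versions have the same Laplace expansion, the original column
determinants agree with the modified ones (`colSum_id_updateCol`). Row determinants are
conjugates of column determinants of the conjugate transpose (`star_rdet`), so all row and column
determinants of a Hermitian matrix have a common real value (`hdet_principal`).

*The formula.* Let `S s` be the sum of the cofactor matrices of all principal submatrices of order
`s` and `d s` the sum of all principal minors of order `s`. The numerators of the theorem are the
entries of `S r * M`, and Cramer's rule gives the Faddeev–LeVerrier recursion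
`S (s + 1) = d s - S s * M` together with `re (trace (S s * M)) = s * d s`. Let `q` be the largest
`s` with `d s ≠ 0`. Beyond `q` the recursion reads `S (s + 1) = -S s * M`. Since it ends at `0` and
`M` can be cancelled from multiples of `M`, it follows that `S s * M = 0` for `s > q`, and then
`S q * M = d q • P`. Taking traces, `q = re (trace P)`, which is the rank of the idempotent `P`
(`re_trace_eq_qrank`); so `q = r`. The row formula is the conjugate of the column formula.
-/

noncomputable section

namespace QuatDrazin

/-! ### Sums, products and conjugation of quaternions -/

theorem re_mul_comm (a b : Quaternion ℝ) : (a * b).re = (b * a).re := by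
  simp only [Quaternion.re_mul]
  ring

theorem re_sum {κ : Type*} (s : Finset κ) (f : κ → Quaternion ℝ) :
    (∑ x ∈ s, f x).re = ∑ x ∈ s, (f x).re := by
  classical
  induction s using Finset.induction_on with
  | empty => rfl
  | insert a s ha ih => simp [Finset.sum_insert ha, ih]

theorem coe_sum {κ : Type*} (s : Finset κ) (f : κ → ℝ) :
    ((∑ x ∈ s, f x : ℝ) : Quaternion ℝ) = ∑ x ∈ s, (f x : Quaternion ℝ) :=
  map_sum (algebraMap ℝ (Quaternion ℝ)) f s

theorem star_list_prod (L : List (Quaternion ℝ)) : star L.prod = (L.map star).reverse.prod := by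
  induction L with
  | nil => simp
  | cons a L ih => simp [ih]

/-! ### Removing one point from a cycle of a permutation

If `τ` fixes `l ≠ i`, then `swap l i * τ` arises from `τ` by inserting `l` into the cycle of `i`,
immediately before `i`. -/

section Contraction

variable {ι : Type*}

theorem pow_minimalPeriod_apply (σ : Equiv.Perm ι) (x : ι) :
    (σ ^ Function.minimalPeriod σ x) x = x := by
  rw [← Equiv.Perm.iterate_eq_pow]
  exact Function.isPeriodicPt_minimalPeriod σ x

section

variable [DecidableEq ι] {τ : Equiv.Perm ι} {i l : ι}

theorem swap_mul_apply_of_ne (hl : τ l = l) {x : ι} (hx : x ≠ l) (hxi : τ x ≠ i) :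
    (Equiv.swap l i * τ) x = τ x := by
  rw [Equiv.Perm.mul_apply, Equiv.swap_apply_of_ne_of_ne _ hxi]
  intro h
  exact hx (τ.injective (h.trans hl.symm))

theorem sameCycle_swap_mul_left (hl : τ l = l) : (Equiv.swap l i * τ).SameCycle i l := by
  have h2 : (Equiv.swap l i * τ) l = i := by simp [hl]
  conv => lhs; rw [← h2]
  rw [Equiv.Perm.sameCycle_apply_left]

/-- A cycle that does not meet the modified one is not affected by the insertion of `l`. -/
theorem swap_mul_pow_apply_of_not_sameCycle (hl : τ l = l) {x : ι} (hx : x ≠ l)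
    (hxi : ¬ τ.SameCycle i x) (m : ℕ) : ((Equiv.swap l i * τ) ^ m) x = (τ ^ m) x := by
  induction m with
  | zero => rfl
  | succ m ih =>
    rw [pow_succ', pow_succ', Equiv.Perm.mul_apply, ih, Equiv.Perm.mul_apply τ]
    refine swap_mul_apply_of_ne hl ?_ ?_
    · intro h
      have h1 : (τ ^ m) l = l := Function.IsFixedPt.perm_pow hl _
      exact hx ((τ ^ m).injective (h.trans h1.symm))
    · intro h
      apply hxi
      rw [← h, Equiv.Perm.sameCycle_apply_left, Equiv.Perm.sameCycle_pow_left]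

theorem swap_mul_pow_apply_of_lt (hl : τ l = l) (hil : l ≠ i) {m : ℕ}
    (hm : m < Function.minimalPeriod τ i) : ((Equiv.swap l i * τ) ^ m) i = (τ ^ m) i := by
  induction m with
  | zero => rfl
  | succ m ih =>
    rw [pow_succ', pow_succ', Equiv.Perm.mul_apply, ih (by omega), Equiv.Perm.mul_apply τ]
    refine swap_mul_apply_of_ne hl ?_ ?_
    · intro h
      have h1 : (τ ^ m) l = l := Function.IsFixedPt.perm_pow hl _
      exact hil.symm ((τ ^ m).injective (h.trans h1.symm))
    · intro h
      rw [← Equiv.Perm.mul_apply, ← pow_succ', ← Equiv.Perm.iterate_eq_pow] at h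
      exact Function.not_isPeriodicPt_of_pos_of_lt_minimalPeriod (Nat.succ_ne_zero m) hm h

end

variable [Finite ι]

theorem minimalPeriod_pos (σ : Equiv.Perm ι) (x : ι) : 0 < Function.minimalPeriod σ x := by
  refine Function.minimalPeriod_pos_of_mem_periodicPts ?_
  exact Function.Injective.mem_periodicPts σ.injective x

/-- An equivalence relation that relates every point of an invariant set to its image relates any
two points of this set in the same cycle. -/
theorem sameCycle_of_forall_step {r : ι → ι → Prop} (hr : Equivalence r) {σ : Equiv.Perm ι}
    {s : Set ι} (hs : ∀ x ∈ s, σ x ∈ s) (h : ∀ x ∈ s, r x (σ x)) {x y : ι} (hx : x ∈ s)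
    (hxy : σ.SameCycle x y) : r x y := by
  obtain ⟨m, rfl⟩ := hxy.exists_nat_pow_eq
  have key : (σ ^ m) x ∈ s ∧ r x ((σ ^ m) x) := by
    induction m with
    | zero => exact ⟨by simpa using hx, by simpa using hr.refl x⟩
    | succ m ih =>
      rw [pow_succ', Equiv.Perm.mul_apply]
      have ih := ih (Equiv.Perm.sameCycle_pow_right.2 (Equiv.Perm.SameCycle.refl σ x))
      exact ⟨hs _ ih.1, hr.trans ih.2 (h _ ih.1)⟩
  exact key.2

variable [DecidableEq ι] {τ : Equiv.Perm ι} {i l : ι}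

theorem sameCycle_swap_mul (hl : τ l = l) (hil : l ≠ i) {x y : ι} (hx : x ≠ l) (hy : y ≠ l) :
    (Equiv.swap l i * τ).SameCycle x y ↔ τ.SameCycle x y := by
  constructor
  · intro h
    -- Collapsing `l` to `i` turns every step of the longer cycle into a step of the shorter one.
    have := sameCycle_of_forall_step
      (r := fun a b => τ.SameCycle (if a = l then i else a) (if b = l then i else b))
      ⟨fun _ => .refl _ _, fun h => h.symm, fun h h' => h.trans h'⟩ (s := Set.univ)
      (fun _ _ => trivial) (fun a _ => ?_) (Set.mem_univ x) h
    · simpa [hx, hy] using this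
    · by_cases ha : a = l
      · subst ha
        simp [hl, hil.symm, Equiv.Perm.SameCycle.refl]
      · by_cases hai : τ a = i
        · have : (Equiv.swap l i * τ) a = l := by simp [hai]
          rw [if_neg ha, this, if_pos rfl, ← hai]
          exact Equiv.Perm.sameCycle_apply_right.2 (.refl _ _)
        · rw [swap_mul_apply_of_ne hl ha hai, if_neg ha, if_neg]
          · exact Equiv.Perm.sameCycle_apply_right.2 (.refl _ _)
          · intro h'
            exact ha (τ.injective (h'.trans hl.symm))
  · refine sameCycle_of_forall_step (r := (Equiv.swap l i * τ).SameCycle) (s := {x | x ≠ l})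
      ⟨fun _ => .refl _ _, fun h => h.symm, fun h h' => h.trans h'⟩
      (fun a ha h' => ha (τ.injective (h'.trans hl.symm))) (fun a ha => ?_) hx
    by_cases hai : τ a = i
    · have h1 : (Equiv.swap l i * τ) a = l := by simp [hai]
      have h2 : (Equiv.swap l i * τ) l = i := by simp [hl]
      have h3 : (Equiv.swap l i * τ) ((Equiv.swap l i * τ) a) = τ a := by rw [h1, h2, hai]
      rw [← h3, Equiv.Perm.sameCycle_apply_right, Equiv.Perm.sameCycle_apply_right]
    · rw [← swap_mul_apply_of_ne hl ha hai, Equiv.Perm.sameCycle_apply_right]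

theorem swap_mul_pow_minimalPeriod (hl : τ l = l) (hil : l ≠ i) :
    ((Equiv.swap l i * τ) ^ Function.minimalPeriod τ i) i = l := by
  obtain ⟨p, hp⟩ : ∃ p, Function.minimalPeriod τ i = p + 1 :=
    Nat.exists_eq_succ_of_ne_zero (minimalPeriod_pos τ i).ne'
  have h := pow_minimalPeriod_apply τ i
  rw [hp] at h ⊢
  rw [pow_succ', Equiv.Perm.mul_apply, swap_mul_pow_apply_of_lt hl hil (by omega),
    Equiv.Perm.mul_apply, ← Equiv.Perm.mul_apply τ, ← pow_succ', h, Equiv.swap_apply_right]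

theorem minimalPeriod_swap_mul (hl : τ l = l) (hil : l ≠ i) :
    Function.minimalPeriod (Equiv.swap l i * τ : Equiv.Perm ι) i
      = Function.minimalPeriod τ i + 1 := by
  have h1 := swap_mul_pow_minimalPeriod hl hil
  refine le_antisymm ?_ ?_
  · refine Function.IsPeriodicPt.minimalPeriod_le (Nat.succ_pos _) ?_
    rw [Function.IsPeriodicPt, Function.IsFixedPt, Equiv.Perm.iterate_eq_pow, pow_succ',
      Equiv.Perm.mul_apply, h1]
    simp [hl]
  · by_contra hlt
    have hpos := minimalPeriod_pos (Equiv.swap l i * τ) i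
    have h2 := pow_minimalPeriod_apply (Equiv.swap l i * τ) i
    rcases (Nat.lt_succ_iff.1 (not_le.1 hlt)).lt_or_eq with h | h
    · rw [swap_mul_pow_apply_of_lt hl hil h, ← Equiv.Perm.iterate_eq_pow] at h2
      exact Function.not_isPeriodicPt_of_pos_of_lt_minimalPeriod hpos.ne' h h2
    · rw [h, h1] at h2
      exact hil h2

end Contraction

/-! ### Cycle products -/

section CycleProd

variable {ι : Type*}

theorem cycleProd_congr {κ : Type*}
    {A : Matrix ι ι (Quaternion ℝ)} {B : Matrix κ κ (Quaternion ℝ)}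
    {σ : Equiv.Perm ι} {τ : Equiv.Perm κ} {x : ι} {y : κ}
    (hp : ∀ m, (σ ^ m) x = x ↔ (τ ^ m) y = y)
    (h : ∀ m, A ((σ ^ m) x) ((σ ^ (m + 1)) x) = B ((τ ^ m) y) ((τ ^ (m + 1)) y)) :
    cycleProd A σ x = cycleProd B τ y := by
  have hper : Function.minimalPeriod σ x = Function.minimalPeriod τ y := by
    rw [Function.minimalPeriod_eq_minimalPeriod_iff]
    intro m
    simpa [Function.IsPeriodicPt, Function.IsFixedPt, Equiv.Perm.iterate_eq_pow] using hp m
  unfold cycleProd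
  rw [hper]
  congr 1
  exact List.map_congr_left fun m _ => h m

theorem cycleProd_of_fixed (A : Matrix ι ι (Quaternion ℝ)) {σ : Equiv.Perm ι} {x : ι}
    (h : σ x = x) : cycleProd A σ x = A x x := by
  have h1 : Function.minimalPeriod σ x = 1 := Function.minimalPeriod_eq_one_iff_isFixedPt.2 h
  simp [cycleProd, h1, h]

/-- Conjugating a cycle product reverses the cycle. -/
theorem star_cycleProd (A : Matrix ι ι (Quaternion ℝ)) (σ : Equiv.Perm ι) (x : ι) :
    star (cycleProd A σ x) = cycleProd Aᴴ σ⁻¹ x := by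
  have hp : Function.minimalPeriod (σ⁻¹ : Equiv.Perm ι) x = Function.minimalPeriod σ x := by
    rw [Function.minimalPeriod_eq_minimalPeriod_iff]
    intro m
    simp only [Function.IsPeriodicPt, Function.IsFixedPt, Equiv.Perm.iterate_eq_pow, inv_pow]
    rw [Equiv.Perm.inv_eq_iff_eq, eq_comm]
  unfold cycleProd
  rw [star_list_prod, hp, ← List.map_reverse, ← List.map_reverse, List.map_map]
  set p := Function.minimalPeriod σ x with hpdef
  have hrev : (List.range p).reverse = (List.range p).map fun m => p - 1 - m := by
    refine List.ext_getElem (by simp) fun m h1 h2 => ?_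
    simp
  rw [hrev, List.map_map]
  congr 1
  refine List.map_congr_left fun m hm => ?_
  have hm : m < p := List.mem_range.1 hm
  have hpow : ∀ a c : ℕ, a + c = p → (σ⁻¹ ^ a) x = (σ ^ c) x := by
    intro a c hac
    rw [inv_pow, Equiv.Perm.inv_eq_iff_eq, ← Equiv.Perm.mul_apply, ← pow_add, hac,
      pow_minimalPeriod_apply]
  simp only [Function.comp, Matrix.conjTranspose_apply]
  rw [hpow m (p - 1 - m + 1) (by omega), hpow (m + 1) (p - 1 - m) (by omega)]

section

variable [DecidableEq ι]

theorem cycleProd_updateCol (M : Matrix ι ι (Quaternion ℝ)) (b : ι → Quaternion ℝ)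
    {σ : Equiv.Perm ι} {i x : ι} (h : ¬ σ.SameCycle i x) :
    cycleProd (M.updateCol i b) σ x = cycleProd M σ x := by
  refine cycleProd_congr (fun _ => Iff.rfl) fun m => ?_
  rw [Matrix.updateCol_ne]
  intro h'
  apply h
  rw [← h', Equiv.Perm.sameCycle_pow_left]

theorem cycleProd_swap_mul_of_not_sameCycle (M : Matrix ι ι (Quaternion ℝ))
    {τ : Equiv.Perm ι} {i l x : ι} (hl : τ l = l) (hx : x ≠ l) (hxi : ¬ τ.SameCycle i x) :
    cycleProd M (Equiv.swap l i * τ) x = cycleProd M τ x := by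
  have h := swap_mul_pow_apply_of_not_sameCycle hl hx hxi
  exact cycleProd_congr (fun m => by rw [h]) fun m => by rw [h, h]

end

variable [Finite ι]

/-- The real part of a cycle product does not depend on the starting point of the cycle. -/
theorem re_cycleProd_apply (A : Matrix ι ι (Quaternion ℝ)) (σ : Equiv.Perm ι) (x : ι) :
    (cycleProd A σ (σ x)).re = (cycleProd A σ x).re := by
  have hp : Function.minimalPeriod σ (σ x) = Function.minimalPeriod σ x :=
    Function.minimalPeriod_apply (Function.Injective.mem_periodicPts σ.injective x)
  obtain ⟨p, hpp⟩ : ∃ p, Function.minimalPeriod σ x = p + 1 :=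
    Nat.exists_eq_succ_of_ne_zero (minimalPeriod_pos σ x).ne'
  have hx : (σ ^ (p + 1)) x = x := hpp ▸ pow_minimalPeriod_apply σ x
  have hs : ∀ m : ℕ, (σ ^ m) (σ x) = (σ ^ (m + 1)) x := fun m => by
    rw [pow_succ, Equiv.Perm.mul_apply]
  have h1 : cycleProd A σ (σ x)
      = ((List.range p).map fun m => A ((σ ^ (m + 1)) x) ((σ ^ (m + 1 + 1)) x)).prod
        * A x (σ x) := by
    unfold cycleProd
    rw [hp, hpp, List.range_succ, List.map_append, List.prod_append]
    simp only [hs, List.map_singleton, List.prod_singleton]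
    rw [hx, pow_succ' σ (p + 1), Equiv.Perm.mul_apply, hx]
  have h2 : cycleProd A σ x = A x (σ x)
      * ((List.range p).map fun m => A ((σ ^ (m + 1)) x) ((σ ^ (m + 1 + 1)) x)).prod := by
    unfold cycleProd
    rw [hpp, List.range_succ_eq_map, List.map_cons, List.prod_cons, List.map_map]
    rfl
  rw [h1, h2, re_mul_comm]

theorem re_cycleProd_eq (A : Matrix ι ι (Quaternion ℝ)) {σ : Equiv.Perm ι} {x y : ι}
    (h : σ.SameCycle x y) : (cycleProd A σ x).re = (cycleProd A σ y).re :=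
  sameCycle_of_forall_step (r := fun x y => (cycleProd A σ x).re = (cycleProd A σ y).re)
    ⟨fun _ => rfl, Eq.symm, Eq.trans⟩ (s := Set.univ) (fun _ _ => trivial)
    (fun x _ => (re_cycleProd_apply A σ x).symm) (Set.mem_univ x) h

variable [DecidableEq ι]

/-- Inserting `l` as the last point of the cycle opened by `i`: the arrow `y → i` that closed the
cycle becomes `y → l`, so the column that replaces the `i`th one is now the `l`th column of `M`. -/
theorem cycleProd_swap_mul (M : Matrix ι ι (Quaternion ℝ)) (b : ι → Quaternion ℝ)
    {τ : Equiv.Perm ι} {i l : ι} (hl : τ l = l) (hil : l ≠ i) :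
    cycleProd (M.updateCol i b) (Equiv.swap l i * τ) i
      = cycleProd (M.updateCol i (M.col l)) τ i * b l := by
  have hσl : (Equiv.swap l i * τ) l = i := by simp [hl]
  have hend := swap_mul_pow_minimalPeriod hl hil
  have hstep : (((Equiv.swap l i * τ) ^ (Function.minimalPeriod τ i + 1)) i) = i := by
    rw [pow_succ', Equiv.Perm.mul_apply, hend, hσl]
  unfold cycleProd
  rw [minimalPeriod_swap_mul hl hil, List.range_succ, List.map_append, List.prod_append,
    List.map_singleton, List.prod_singleton, hstep, hend, Matrix.updateCol_self]
  congr 2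
  refine List.map_congr_left fun m hm => ?_
  have hm : m < Function.minimalPeriod τ i := List.mem_range.1 hm
  rw [swap_mul_pow_apply_of_lt hl hil hm]
  rcases (Nat.succ_le_of_lt hm).lt_or_eq with h | h
  · have hne : (τ ^ (m + 1)) i ≠ i := by
      intro h'
      rw [← Equiv.Perm.iterate_eq_pow] at h'
      exact Function.not_isPeriodicPt_of_pos_of_lt_minimalPeriod (Nat.succ_ne_zero m) h h'
    rw [swap_mul_pow_apply_of_lt hl hil h, Matrix.updateCol_ne hne, Matrix.updateCol_ne hne]
  · have h : m + 1 = Function.minimalPeriod τ i := h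
    rw [h, hend, pow_minimalPeriod_apply, Matrix.updateCol_ne hil, Matrix.updateCol_self,
      Matrix.col_apply]

end CycleProd

/-! ### Row and column determinants over an index set -/

section DeterminantsOn

variable {ι : Type*} [LinearOrder ι]

/-- The product of `φ` of the products along the cycles that start at the elements of `s`, the
larger ones first. -/
def cyclesProd (φ : Quaternion ℝ → Quaternion ℝ) (A : Matrix ι ι (Quaternion ℝ))
    (σ : Equiv.Perm ι) (s : Finset ι) : Quaternion ℝ :=
  ((s.sort (· ≤ ·)).reverse.map fun x => φ (cycleProd A σ x)).prod

theorem cyclesProd_congr {φ : Quaternion ℝ → Quaternion ℝ} {A B : Matrix ι ι (Quaternion ℝ)}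
    {σ τ : Equiv.Perm ι} {s : Finset ι} (h : ∀ x ∈ s, cycleProd A σ x = cycleProd B τ x) :
    cyclesProd φ A σ s = cyclesProd φ B τ s := by
  unfold cyclesProd
  congr 1
  refine List.map_congr_left fun x hx => ?_
  rw [h x (by simpa using hx)]

theorem cyclesProd_insert {φ : Quaternion ℝ → Quaternion ℝ} {A : Matrix ι ι (Quaternion ℝ)}
    {σ : Equiv.Perm ι} {s : Finset ι} {x : ι} (h : ∀ y ∈ s, x < y) :
    cyclesProd φ A σ (insert x s) = cyclesProd φ A σ s * φ (cycleProd A σ x) := by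
  unfold cyclesProd
  rw [Finset.sort_insert (· ≤ ·) (fun y hy => (h y hy).le) fun hx => lt_irrefl _ (h x hx)]
  simp

theorem cyclesProd_re (A : Matrix ι ι (Quaternion ℝ)) (σ : Equiv.Perm ι) (s : Finset ι) :
    cyclesProd (fun q => (q.re : Quaternion ℝ)) A σ s
      = ((∏ x ∈ s, (cycleProd A σ x).re : ℝ) : Quaternion ℝ) := by
  have h : ∀ L : List ι, (L.map fun x => ((cycleProd A σ x).re : Quaternion ℝ)).prod
      = (((L.map fun x => (cycleProd A σ x).re).prod : ℝ) : Quaternion ℝ) := by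
    intro L
    induction L with
    | nil => simp
    | cons a L ih => simp [ih]
  rw [cyclesProd, h, List.map_reverse, List.prod_reverse, Finset.prod_eq_multiset_prod,
    ← Finset.sort_eq s (· ≤ ·), Multiset.map_coe, Multiset.prod_coe]

theorem ofSubtype_pow_apply {β : Finset ι} (σ : Equiv.Perm β) (x : β) (m : ℕ) :
    ((Equiv.Perm.ofSubtype σ : Equiv.Perm ι) ^ m) x = ((σ ^ m) x : β) := by
  rw [← map_pow, Equiv.Perm.ofSubtype_apply_coe]

theorem sameCycle_ofSubtype {β : Finset ι} (σ : Equiv.Perm β) (x y : β) :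
    (Equiv.Perm.ofSubtype σ : Equiv.Perm ι).SameCycle x y ↔ σ.SameCycle x y := by
  unfold Equiv.Perm.SameCycle
  refine exists_congr fun m => ?_
  rw [← map_zpow, Equiv.Perm.ofSubtype_apply_coe, Subtype.coe_inj]

variable [Fintype ι]

/-- The permutations of `ι` that fix every point outside of `β`; they stand for the permutations
of `β`. -/
def permsOn (β : Finset ι) : Finset (Equiv.Perm ι) :=
  open Classical in Finset.univ.filter fun σ => ∀ x ∉ β, σ x = x

/-- The smallest elements of the cycles of `σ` inside `β`, for `σ` in `permsOn β`. -/
def cycleMins (β : Finset ι) (σ : Equiv.Perm ι) : Finset ι :=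
  open Classical in β.filter fun x => ∀ y, σ.SameCycle x y → x ≤ y

/-- The smallest elements of the cycles of `σ` inside `β` that do not contain `i`. -/
def otherMins (β : Finset ι) (σ : Equiv.Perm ι) (i : ι) : Finset ι :=
  open Classical in β.filter fun x => ¬ σ.SameCycle i x ∧ ∀ y, σ.SameCycle x y → x ≤ y

theorem mem_permsOn {β : Finset ι} {σ : Equiv.Perm ι} :
    σ ∈ permsOn β ↔ ∀ x ∉ β, σ x = x := by
  simp [permsOn]

theorem mem_cycleMins {β : Finset ι} {σ : Equiv.Perm ι} {x : ι} :
    x ∈ cycleMins β σ ↔ x ∈ β ∧ ∀ y, σ.SameCycle x y → x ≤ y := by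
  simp [cycleMins]

theorem mem_otherMins {β : Finset ι} {σ : Equiv.Perm ι} {i x : ι} :
    x ∈ otherMins β σ i ↔ x ∈ β ∧ ¬ σ.SameCycle i x ∧ ∀ y, σ.SameCycle x y → x ≤ y := by
  simp [otherMins]

/-- The column determinant along the `i`th column of the principal submatrix of `A` on `β`, with
the products along the cycles that do not contain `i` modified by `φ`. The column determinant
itself is the case `φ = id`, and `φ = (↑) ∘ re` makes the order of the cycles irrelevant. -/
def colSum (φ : Quaternion ℝ → Quaternion ℝ) (β : Finset ι) (i : ι)
    (A : Matrix ι ι (Quaternion ℝ)) : Quaternion ℝ :=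
  ∑ σ ∈ permsOn β,
    ((Equiv.Perm.sign σ : ℤ) : Quaternion ℝ) *
      (cyclesProd φ A σ (otherMins β σ i) * cycleProd A σ i)

/-- The signed sum over the permutations of `β` of the products of `φ` of all cycle products, each
cycle being opened by its smallest element. -/
def minSum (φ : Quaternion ℝ → Quaternion ℝ) (β : Finset ι)
    (A : Matrix ι ι (Quaternion ℝ)) : Quaternion ℝ :=
  ∑ σ ∈ permsOn β,
    ((Equiv.Perm.sign σ : ℤ) : Quaternion ℝ) * cyclesProd φ A σ (cycleMins β σ)

theorem permsOn_erase (β : Finset ι) {i : ι} (hi : i ∈ β) :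
    permsOn (β.erase i) = (permsOn β).filter fun σ => σ⁻¹ i = i := by
  ext σ
  simp only [mem_permsOn, Finset.mem_filter, Finset.mem_erase, not_and_or, not_not,
    Equiv.Perm.inv_eq_iff_eq]
  constructor
  · exact fun h => ⟨fun x hx => h x (Or.inr hx), (h i (Or.inl rfl)).symm⟩
  · rintro ⟨h, h'⟩ x (rfl | hx)
    · exact h'.symm
    · exact h x hx

theorem otherMins_of_fixed {β : Finset ι} {σ : Equiv.Perm ι} {i : ι} (h : σ i = i) :
    otherMins β σ i = cycleMins (β.erase i) σ := by
  ext x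
  simp only [mem_otherMins, mem_cycleMins, Finset.mem_erase]
  have : σ.SameCycle i x ↔ x = i := by
    constructor
    · exact fun h' => (h'.eq_of_left h).symm
    · rintro rfl
      exact .refl _ _
  rw [this]
  tauto

theorem otherMins_swap_mul {β : Finset ι} {τ : Equiv.Perm ι} {i l : ι} (hl : τ l = l)
    (hil : l ≠ i) : otherMins β (Equiv.swap l i * τ) i = otherMins (β.erase l) τ i := by
  ext x
  simp only [mem_otherMins, Finset.mem_erase]
  by_cases hx : x = l
  · subst hx
    simp [sameCycle_swap_mul_left hl]
  · rw [sameCycle_swap_mul hl hil hil.symm hx]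
    have hmin : ¬ τ.SameCycle i x → ((∀ y, (Equiv.swap l i * τ).SameCycle x y → x ≤ y) ↔
        ∀ y, τ.SameCycle x y → x ≤ y) := by
      intro hix
      refine forall_congr' fun y => ?_
      by_cases hy : y = l
      · subst hy
        have h1 : ¬ (Equiv.swap y i * τ).SameCycle x y := fun h =>
          hix ((sameCycle_swap_mul hl hil hil.symm hx).1
            ((sameCycle_swap_mul_left hl).trans h.symm))
        have h2 : ¬ τ.SameCycle x y := fun h => hx (h.eq_of_right hl)
        simp [h1, h2]
      · rw [sameCycle_swap_mul hl hil hx hy]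
    tauto

/-- Inserting `l` before `i` is a bijection from the permutations of `β.erase l` to the permutations
of `β` that send `l` to `i`. -/
theorem swap_mul_mem_permsOn {β : Finset ι} {τ : Equiv.Perm ι} {i l : ι} (hi : i ∈ β) (hl : l ∈ β)
    (hil : l ≠ i) : (Equiv.swap l i * τ ∈ permsOn β ∧ (Equiv.swap l i * τ)⁻¹ i = l) ↔
      τ ∈ permsOn (β.erase l) := by
  simp only [mem_permsOn, Equiv.Perm.inv_eq_iff_eq, Equiv.Perm.mul_apply, Finset.mem_erase,
    not_and_or, not_not]
  constructor
  · rintro ⟨h, h'⟩ x (rfl | hx)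
    · rw [eq_comm, Equiv.swap_apply_eq_iff, Equiv.swap_apply_right] at h'
      exact h'
    · have h1 := h x hx
      rw [Equiv.swap_apply_eq_iff, Equiv.swap_apply_of_ne_of_ne] at h1
      · exact h1
      · rintro rfl; exact hx hl
      · rintro rfl; exact hx hi
  · intro h
    refine ⟨fun x hx => ?_, by rw [h l (Or.inl rfl), Equiv.swap_apply_left]⟩
    rw [h x (Or.inr hx), Equiv.swap_apply_of_ne_of_ne]
    · rintro rfl; exact hx hl
    · rintro rfl; exact hx hi

/-- The Laplace expansion along the `i`th column: in the cycle of `i`, the entry of the `i`th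
column stands last, and it is split off by removing its row index `l` from the cycle. -/
theorem colSum_updateCol (φ : Quaternion ℝ → Quaternion ℝ) (M : Matrix ι ι (Quaternion ℝ))
    (b : ι → Quaternion ℝ) {β : Finset ι} {i : ι} (hi : i ∈ β) :
    colSum φ β i (M.updateCol i b) = minSum φ (β.erase i) M * b i
      - ∑ l ∈ β.erase i, colSum φ (β.erase l) i (M.updateCol i (M.col l)) * b l := by
  have hmaps : ∀ σ ∈ permsOn β, σ⁻¹ i ∈ β := by
    intro σ hσ
    by_contra h
    have h1 := mem_permsOn.1 hσ _ h
    rw [← Equiv.Perm.mul_apply, mul_inv_cancel, Equiv.Perm.one_apply] at h1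
    exact h (h1 ▸ hi)
  have hcol : ∀ {σ : Equiv.Perm ι} (c : ι → Quaternion ℝ) (δ : Finset ι),
      cyclesProd φ (M.updateCol i c) σ (otherMins δ σ i)
        = cyclesProd φ M σ (otherMins δ σ i) := fun c δ =>
    cyclesProd_congr fun x hx => cycleProd_updateCol M c (mem_otherMins.1 hx).2.1
  conv_lhs => unfold colSum
  rw [← Finset.sum_fiberwise_of_maps_to hmaps, ← Finset.add_sum_erase _ _ hi, sub_eq_add_neg,
    ← Finset.sum_neg_distrib]
  congr 1
  · rw [← permsOn_erase β hi, minSum, Finset.sum_mul]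
    refine Finset.sum_congr rfl fun σ hσ => ?_
    have hσi : σ i = i := mem_permsOn.1 hσ i (Finset.notMem_erase i β)
    rw [hcol, otherMins_of_fixed hσi, cycleProd_of_fixed _ hσi, Matrix.updateCol_self, mul_assoc]
  · refine Finset.sum_congr rfl fun l hl => ?_
    obtain ⟨hil, hlβ⟩ := Finset.mem_erase.1 hl
    rw [colSum, Finset.sum_mul, ← Finset.sum_neg_distrib]
    refine Finset.sum_bij' (fun σ _ => Equiv.swap l i * σ) (fun τ _ => Equiv.swap l i * τ)
      (fun σ hσ => ?_) (fun τ hτ => ?_) (fun σ _ => Equiv.swap_mul_self_mul _ _ _)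
      (fun σ _ => Equiv.swap_mul_self_mul _ _ _) (fun σ hσ => ?_)
    · rw [← swap_mul_mem_permsOn hi hlβ hil, Equiv.swap_mul_self_mul]
      exact Finset.mem_filter.1 hσ
    · exact Finset.mem_filter.2 ((swap_mul_mem_permsOn hi hlβ hil).2 hτ)
    · obtain ⟨τ, rfl⟩ : ∃ τ, σ = Equiv.swap l i * τ :=
        ⟨Equiv.swap l i * σ, (Equiv.swap_mul_self_mul _ _ _).symm⟩
      have hτ := (swap_mul_mem_permsOn hi hlβ hil).1 (Finset.mem_filter.1 hσ)
      have hτl : τ l = l := mem_permsOn.1 hτ l (Finset.notMem_erase l β)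
      rw [Equiv.swap_mul_self_mul, hcol, hcol, otherMins_swap_mul hτl hil,
        cycleProd_swap_mul M b hτl hil, Equiv.Perm.sign_mul, Equiv.Perm.sign_swap hil]
      have : cyclesProd φ M (Equiv.swap l i * τ) (otherMins (β.erase l) τ i)
          = cyclesProd φ M τ (otherMins (β.erase l) τ i) := by
        refine cyclesProd_congr fun x hx => ?_
        obtain ⟨h1, h2, -⟩ := mem_otherMins.1 hx
        exact cycleProd_swap_mul_of_not_sameCycle M hτl (Finset.ne_of_mem_erase h1) h2
      rw [this]
      simp [mul_assoc]

theorem minSum_empty (φ : Quaternion ℝ → Quaternion ℝ) (A : Matrix ι ι (Quaternion ℝ)) :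
    minSum φ ∅ A = 1 := by
  have h : permsOn (∅ : Finset ι) = {1} := by
    ext σ
    simp [mem_permsOn, Equiv.ext_iff]
  have h' : cycleMins (∅ : Finset ι) 1 = ∅ := by
    ext x
    simp [mem_cycleMins]
  rw [minSum, h, Finset.sum_singleton, h']
  simp [cyclesProd]

/-- For the smallest index, the two ways of choosing the openers of the cycles agree. -/
theorem minSum_id_eq (A : Matrix ι ι (Quaternion ℝ)) {β : Finset ι} {i : ι} (hi : i ∈ β)
    (hmin : ∀ x ∈ β, i ≤ x) : minSum id β A = colSum id β i A := by
  refine Finset.sum_congr rfl fun σ hσ => ?_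
  have hmem : ∀ y, σ.SameCycle i y → i ≤ y := by
    intro y hy
    by_cases hyβ : y ∈ β
    · exact hmin y hyβ
    · exact (hy.eq_of_right (mem_permsOn.1 hσ y hyβ)).le
  have hins : cycleMins β σ = insert i (otherMins β σ i) := by
    ext x
    simp only [mem_cycleMins, Finset.mem_insert, mem_otherMins]
    constructor
    · rintro ⟨h1, h2⟩
      by_cases hx : σ.SameCycle i x
      · exact Or.inl (le_antisymm (h2 i hx.symm) (hmem x hx))
      · exact Or.inr ⟨h1, hx, h2⟩
    · rintro (rfl | ⟨h1, -, h2⟩)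
      · exact ⟨hi, hmem⟩
      · exact ⟨h1, h2⟩
  rw [hins, cyclesProd_insert]
  · rfl
  · intro y hy
    obtain ⟨h1, h2, -⟩ := mem_otherMins.1 hy
    refine lt_of_le_of_ne (hmin y h1) ?_
    rintro rfl
    exact h2 (.refl _ _)

/-- The signed sum over the permutations of `β` of the products of the real parts of all cycle
products. -/
def reDet (A : Matrix ι ι (Quaternion ℝ)) (β : Finset ι) : ℝ :=
  ∑ σ ∈ permsOn β,
    ((Equiv.Perm.sign σ : ℤ) : ℝ) * ∏ x ∈ cycleMins β σ, (cycleProd A σ x).re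

theorem sign_cast (σ : Equiv.Perm ι) : ((Equiv.Perm.sign σ : ℤ) : Quaternion ℝ)
    = (((Equiv.Perm.sign σ : ℤ) : ℝ) : Quaternion ℝ) :=
  (map_intCast (algebraMap ℝ (Quaternion ℝ)) _).symm

theorem minSum_re (A : Matrix ι ι (Quaternion ℝ)) (β : Finset ι) :
    minSum (fun q => (q.re : Quaternion ℝ)) β A = (reDet A β : Quaternion ℝ) := by
  rw [minSum, reDet, coe_sum]
  refine Finset.sum_congr rfl fun σ _ => ?_
  rw [cyclesProd_re, Quaternion.coe_mul, sign_cast]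

theorem re_colSum_re (A : Matrix ι ι (Quaternion ℝ)) {β : Finset ι} {i : ι} (hi : i ∈ β) :
    (colSum (fun q => (q.re : Quaternion ℝ)) β i A).re = reDet A β := by
  rw [colSum, re_sum, reDet]
  refine Finset.sum_congr rfl fun σ hσ => ?_
  rw [cyclesProd_re, sign_cast, ← mul_assoc, ← Quaternion.coe_mul, Quaternion.coe_mul_eq_smul,
    Quaternion.re_smul, smul_eq_mul, mul_assoc]
  congr 1
  -- The cycle of `i` has a smallest element `x`, which may replace `i` as its opener.
  have hne : (Finset.univ.filter fun x => σ.SameCycle i x).Nonempty :=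
    ⟨i, by simp [Equiv.Perm.SameCycle.refl]⟩
  obtain ⟨x, hx, hxmin⟩ := Finset.exists_min_image _ id hne
  have hx : σ.SameCycle i x := by simpa using hx
  have hxβ : x ∈ β := by
    by_contra h
    have := hx.eq_of_right (mem_permsOn.1 hσ x h)
    exact h (this ▸ hi)
  have hins : cycleMins β σ = insert x (otherMins β σ i) := by
    ext y
    simp only [mem_cycleMins, Finset.mem_insert, mem_otherMins]
    constructor
    · rintro ⟨h1, h2⟩
      by_cases hy : σ.SameCycle i y
      · exact Or.inl (le_antisymm (h2 x (hy.symm.trans hx)) (hxmin y (by simpa using hy)))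
      · exact Or.inr ⟨h1, hy, h2⟩
    · rintro (rfl | ⟨h1, -, h2⟩)
      · exact ⟨hxβ, fun z hz => hxmin z (by simpa using hx.trans hz)⟩
      · exact ⟨h1, h2⟩
  rw [hins, Finset.prod_insert fun h => (mem_otherMins.1 h).2.1 hx, re_cycleProd_eq A hx, mul_comm]

/-! ### Principal submatrices and conjugate transposes -/

/-- The points outside of `β` never open a cycle counted in `otherMins`, and the smallest elements
of the cycles inside `β` are the same in `β` and in `ι`. -/
theorem cdet_principal (A : Matrix ι ι (Quaternion ℝ)) {β : Finset ι} {i : ι} (hi : i ∈ β) :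
    cdet ⟨i, hi⟩ (principal A β) = colSum id β i A := by
  rw [cdet, colSum]
  refine Finset.sum_bij' (fun σ _ => Equiv.Perm.ofSubtype σ)
    (fun τ hτ => ((Equiv.Perm.subtypeEquivSubtypePerm (· ∈ β)).symm ⟨τ, mem_permsOn.1 hτ⟩))
    (fun σ _ => ?_) (fun _ _ => Finset.mem_univ _) (fun σ _ => ?_) (fun τ hτ => ?_)
    (fun σ _ => ?_)
  · exact mem_permsOn.2 fun x hx => Equiv.Perm.ofSubtype_apply_of_not_mem σ hx
  · exact (Equiv.Perm.subtypeEquivSubtypePerm (· ∈ β)).symm_apply_apply σ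
  · exact congrArg Subtype.val
      ((Equiv.Perm.subtypeEquivSubtypePerm (· ∈ β)).apply_symm_apply ⟨τ, mem_permsOn.1 hτ⟩)
  · have hcp : ∀ x : β, cycleProd (principal A β) σ x
        = cycleProd A (Equiv.Perm.ofSubtype σ) x := by
      intro x
      refine cycleProd_congr (fun m => ?_) fun m => ?_
      · rw [ofSubtype_pow_apply, Subtype.coe_inj]
      · rw [ofSubtype_pow_apply, ofSubtype_pow_apply]
        rfl
    rw [Equiv.Perm.sign_ofSubtype]
    congr 1
    rw [cycleOpeners, List.reverse_cons, List.map_append, List.prod_append, List.map_singleton,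
      List.prod_singleton, hcp]
    congr 1
    rw [cyclesProd]
    have hmap : otherMins β (Equiv.Perm.ofSubtype σ) i
        = (Finset.univ.filter fun x : β => ¬ σ.SameCycle ⟨i, hi⟩ x ∧
            ∀ y, σ.SameCycle x y → x ≤ y).map (Function.Embedding.subtype _) := by
      ext x
      simp only [mem_otherMins, Finset.mem_map, Finset.mem_filter, Finset.mem_univ, true_and,
        Function.Embedding.subtype_apply]
      constructor
      · rintro ⟨h1, h2, h3⟩
        refine ⟨⟨x, h1⟩, ⟨fun h => h2 ((sameCycle_ofSubtype σ _ _).2 h), fun y hy =>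
          h3 y ((sameCycle_ofSubtype σ _ _).2 hy)⟩, rfl⟩
      · rintro ⟨x, ⟨h2, h3⟩, rfl⟩
        refine ⟨x.2, fun h => h2 ((sameCycle_ofSubtype σ ⟨i, hi⟩ x).1 h), fun y hy => ?_⟩
        by_cases hyβ : y ∈ β
        · exact h3 ⟨y, hyβ⟩ ((sameCycle_ofSubtype σ x ⟨y, hyβ⟩).1 hy)
        · exact (hy.eq_of_right (Equiv.Perm.ofSubtype_apply_of_not_mem σ hyβ)).le
    rw [hmap, ← Finset.map_sort (Function.Embedding.subtype (· ∈ β)) _ (· ≤ ·) (· ≤ ·)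
      (fun _ _ _ _ => Iff.rfl), ← List.map_reverse, List.map_map]
    congr 1
    · refine List.map_congr_left fun x _ => hcp x

theorem cycleOpeners_inv (σ : Equiv.Perm ι) (i : ι) : cycleOpeners σ⁻¹ i = cycleOpeners σ i := by
  simp only [cycleOpeners, Equiv.Perm.sameCycle_inv]

/-- Conjugation reverses both the order of the cycles and each cycle. -/
theorem star_rdet (i : ι) (A : Matrix ι ι (Quaternion ℝ)) : star (rdet i A) = cdet i Aᴴ := by
  rw [rdet, cdet, star_sum]
  refine Fintype.sum_equiv (Equiv.inv _) _ _ fun σ => ?_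
  rw [star_mul, star_intCast, star_list_prod, Int.cast_comm, Equiv.inv_apply, Equiv.Perm.sign_inv,
    cycleOpeners_inv, List.map_map, ← List.map_reverse]
  congr 2
  exact List.map_congr_left fun x _ => star_cycleProd A σ x

end DeterminantsOn

/-! ### Cofactors of the principal submatrices of a Hermitian matrix -/

section Cofactors

variable {ι : Type*} [Fintype ι] [LinearOrder ι]

/-- The `(i, l)` cofactor of the principal submatrix of `M` on `β`, extended by `0`: the
coefficient of `b l` in the Laplace expansion along the `i`th column when that column is `b`. -/
def cofactor (M : Matrix ι ι (Quaternion ℝ)) (β : Finset ι) (i l : ι) : Quaternion ℝ :=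
  if i ∈ β ∧ l ∈ β then
    if i = l then (reDet M (β.erase i) : Quaternion ℝ)
    else -colSum (fun q => (q.re : Quaternion ℝ)) (β.erase l) i (M.updateCol i (M.col l))
  else 0

theorem cofactor_self (M : Matrix ι ι (Quaternion ℝ)) {β : Finset ι} {i : ι} (hi : i ∈ β) :
    cofactor M β i i = (reDet M (β.erase i) : Quaternion ℝ) := by
  simp [cofactor, hi]

theorem cofactor_of_notMem_left (M : Matrix ι ι (Quaternion ℝ)) {β : Finset ι} {i : ι}
    (hi : i ∉ β) (l : ι) : cofactor M β i l = 0 := by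
  simp [cofactor, hi]

theorem cofactor_of_notMem_right (M : Matrix ι ι (Quaternion ℝ)) {β : Finset ι} {l : ι}
    (hl : l ∉ β) (i : ι) : cofactor M β i l = 0 := by
  simp [cofactor, hl]

theorem colSum_re_updateCol (M : Matrix ι ι (Quaternion ℝ)) (b : ι → Quaternion ℝ)
    {β : Finset ι} {i : ι} (hi : i ∈ β) :
    colSum (fun q => (q.re : Quaternion ℝ)) β i (M.updateCol i b)
      = ∑ l ∈ β, cofactor M β i l * b l := by
  rw [colSum_updateCol _ M b hi, minSum_re, ← Finset.add_sum_erase _ _ hi, cofactor_self M hi,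
    sub_eq_add_neg, ← Finset.sum_neg_distrib]
  congr 1
  refine Finset.sum_congr rfl fun l hl => ?_
  obtain ⟨hli, hlβ⟩ := Finset.mem_erase.1 hl
  simp [cofactor, hi, hlβ, hli.symm]

/-- The recursion for the cofactors that splits off the last factor. -/
theorem cofactor_eq_sum_right (M : Matrix ι ι (Quaternion ℝ)) {β : Finset ι} {i l : ι}
    (hi : i ∈ β) (hl : l ∈ β) (hil : i ≠ l) :
    cofactor M β i l = -∑ y ∈ β.erase l, cofactor M (β.erase l) i y * M y l := by
  have h := colSum_re_updateCol M (M.col l) (Finset.mem_erase.2 ⟨hil, hi⟩)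
  simp only [Matrix.col_apply] at h
  rw [← h, cofactor, if_pos ⟨hi, hl⟩, if_neg hil]

/-- The recursion for the cofactors that splits off the first factor. -/
theorem cofactor_eq_sum_left (M : Matrix ι ι (Quaternion ℝ)) {β : Finset ι} {i l : ι}
    (hi : i ∈ β) (hl : l ∈ β) (hil : i ≠ l) :
    cofactor M β i l = -∑ x ∈ β.erase i, M i x * cofactor M (β.erase i) x l := by
  induction β using Finset.strongInduction generalizing i l with
  | H β ih =>
    have hi' : i ∈ β.erase l := Finset.mem_erase.2 ⟨hil, hi⟩
    have hl' : l ∈ β.erase i := Finset.mem_erase.2 ⟨hil.symm, hl⟩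
    rw [cofactor_eq_sum_right M hi hl hil, ← Finset.add_sum_erase _ _ hi',
      ← Finset.add_sum_erase _ _ hl', cofactor_self M hi', cofactor_self M hl',
      Finset.erase_right_comm, Quaternion.coe_commutes]
    congr 2
    have h1 : ∀ y ∈ (β.erase i).erase l, cofactor M (β.erase l) i y * M y l
        = -∑ x ∈ (β.erase i).erase l, M i x * cofactor M ((β.erase i).erase l) x y * M y l := by
      intro y hy
      simp only [Finset.mem_erase] at hy
      rw [ih _ (Finset.erase_ssubset hl) hi' (Finset.mem_erase.2 ⟨hy.1, hy.2.2⟩) hy.2.1.symm,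
        Finset.erase_right_comm, neg_mul, Finset.sum_mul]
    have h2 : ∀ x ∈ (β.erase i).erase l, M i x * cofactor M (β.erase i) x l
        = -∑ y ∈ (β.erase i).erase l, M i x * cofactor M ((β.erase i).erase l) x y * M y l := by
      intro x hx
      simp only [Finset.mem_erase] at hx
      rw [cofactor_eq_sum_right M (Finset.mem_erase.2 ⟨hx.2.1, hx.2.2⟩) hl' hx.1, mul_neg,
        Finset.mul_sum]
      simp only [mul_assoc]
    rw [Finset.sum_congr rfl h1, Finset.sum_congr rfl h2, Finset.sum_neg_distrib,
      Finset.sum_neg_distrib, Finset.sum_comm]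

variable {M : Matrix ι ι (Quaternion ℝ)}

/-- The matrix of cofactors of a Hermitian matrix is Hermitian: conjugation exchanges the two
recursions. -/
theorem star_cofactor (hM : M.IsHermitian) (β : Finset ι) (i l : ι) :
    star (cofactor M β i l) = cofactor M β l i := by
  induction β using Finset.strongInduction generalizing i l with
  | H β ih =>
    by_cases hi : i ∈ β
    swap
    · rw [cofactor_of_notMem_left M hi, cofactor_of_notMem_right M hi, star_zero]
    by_cases hl : l ∈ β
    swap
    · rw [cofactor_of_notMem_left M hl, cofactor_of_notMem_right M hl, star_zero]
    by_cases hil : i = l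
    · subst hil
      rw [cofactor_self M hi, Quaternion.star_coe]
    · rw [cofactor_eq_sum_left M hi hl hil, cofactor_eq_sum_right M hl hi (Ne.symm hil), star_neg,
        star_sum]
      congr 1
      refine Finset.sum_congr rfl fun x _ => ?_
      rw [star_mul, ih _ (Finset.erase_ssubset hi), hM.apply]

/-- The order-free column determinant of a Hermitian matrix is real, and hence it does not depend
on the column. -/
theorem sum_cofactor_mul_self (hM : M.IsHermitian) {β : Finset ι} {i : ι} (hi : i ∈ β) :
    ∑ l ∈ β, cofactor M β i l * M l i = (reDet M β : Quaternion ℝ) := by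
  have hcol : ∑ l ∈ β, cofactor M β i l * M l i
      = colSum (fun q => (q.re : Quaternion ℝ)) β i M := by
    have h := colSum_re_updateCol M (M.col i) hi
    rw [show M.updateCol i (M.col i) = M from Matrix.updateCol_eq_self M i] at h
    exact h.symm
  have hexp : ∑ l ∈ β, cofactor M β i l * M l i = (reDet M (β.erase i) : Quaternion ℝ) * M i i
      - ∑ l ∈ β.erase i, ∑ x ∈ β.erase i, M i x * cofactor M (β.erase i) x l * M l i := by
    rw [← Finset.add_sum_erase _ _ hi, cofactor_self M hi, sub_eq_add_neg,
      ← Finset.sum_neg_distrib]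
    congr 1
    refine Finset.sum_congr rfl fun l hl => ?_
    obtain ⟨hli, hlβ⟩ := Finset.mem_erase.1 hl
    rw [cofactor_eq_sum_left M hi hlβ (Ne.symm hli), neg_mul, Finset.sum_mul]
  have hstar : star (∑ l ∈ β, cofactor M β i l * M l i) = ∑ l ∈ β, cofactor M β i l * M l i := by
    rw [hexp, star_sub, star_mul, hM.apply, Quaternion.star_coe, Quaternion.coe_commutes, star_sum,
      Finset.sum_comm]
    congr 1
    refine Finset.sum_congr rfl fun l _ => ?_
    rw [star_sum]
    refine Finset.sum_congr rfl fun x _ => ?_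
    rw [star_mul, star_mul, star_cofactor hM, hM.apply, hM.apply, mul_assoc]
  rw [Quaternion.star_eq_self.1 hstar, hcol, re_colSum_re M hi]

/-- Cramer's rule: the matrix of cofactors is a left adjugate of the principal submatrix. -/
theorem sum_cofactor_mul (hM : M.IsHermitian) {β : Finset ι} {i j : ι} (hi : i ∈ β)
    (hj : j ∈ β) : ∑ l ∈ β, cofactor M β i l * M l j
      = if i = j then (reDet M β : Quaternion ℝ) else 0 := by
  induction β using Finset.strongInduction generalizing i with
  | H β ih =>
    by_cases hij : i = j
    · subst hij
      rw [if_pos rfl, sum_cofactor_mul_self hM hi]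
    rw [if_neg hij, ← Finset.add_sum_erase _ _ hi, cofactor_self M hi]
    have hj' : j ∈ β.erase i := Finset.mem_erase.2 ⟨Ne.symm hij, hj⟩
    have h : ∀ l ∈ β.erase i, cofactor M β i l * M l j
        = -∑ x ∈ β.erase i, M i x * (cofactor M (β.erase i) x l * M l j) := by
      intro l hl
      obtain ⟨hli, hlβ⟩ := Finset.mem_erase.1 hl
      rw [cofactor_eq_sum_left M hi hlβ (Ne.symm hli), neg_mul, Finset.sum_mul]
      simp only [mul_assoc]
    rw [Finset.sum_congr rfl h, Finset.sum_neg_distrib, Finset.sum_comm]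
    have h' : ∀ x ∈ β.erase i,
        ∑ l ∈ β.erase i, M i x * (cofactor M (β.erase i) x l * M l j)
          = if x = j then M i x * (reDet M (β.erase i) : Quaternion ℝ) else 0 := by
      intro x hx
      rw [← Finset.mul_sum, ih _ (Finset.erase_ssubset hi) hx hj']
      split_ifs <;> simp
    rw [Finset.sum_congr rfl h', Finset.sum_ite_eq' _ _ _, if_pos hj', Quaternion.coe_commutes,
      add_neg_cancel]

/-! ### The determinant of a Hermitian matrix -/

/-- For a matrix that is Hermitian up to one column, the order of the cycles and the imaginary
parts of the products along the cycles that avoid this column do not matter. -/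
theorem colSum_id_updateCol (hM : M.IsHermitian) (b : ι → Quaternion ℝ) {β : Finset ι} {i : ι}
    (hi : i ∈ β) :
    colSum id β i (M.updateCol i b) = ∑ l ∈ β, cofactor M β i l * b l := by
  rw [← colSum_re_updateCol M b hi]
  induction β using Finset.strongInduction generalizing i b with
  | H β ih =>
    rw [colSum_updateCol _ M b hi, colSum_updateCol _ M b hi]
    congr 1
    · congr 1
      rcases (β.erase i).eq_empty_or_nonempty with h | h
      · rw [h, minSum_empty, minSum_empty]
      · have hm := Finset.min'_mem _ h
        have h1 := ih _ (Finset.erase_ssubset hi) (M.col ((β.erase i).min' h)) hm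
        rw [colSum_re_updateCol M _ hm] at h1
        simp only [Matrix.col_apply] at h1
        rw [sum_cofactor_mul_self hM hm] at h1
        rw [minSum_re, ← h1, minSum_id_eq M hm fun x hx => Finset.min'_le _ x hx]
        exact congrArg _ (Matrix.updateCol_eq_self M _).symm
    · refine Finset.sum_congr rfl fun l hl => ?_
      obtain ⟨hli, hlβ⟩ := Finset.mem_erase.1 hl
      rw [ih _ (Finset.erase_ssubset hlβ) _ (Finset.mem_erase.2 ⟨Ne.symm hli, hi⟩)]

theorem colSum_id_eq_reDet (hM : M.IsHermitian) {β : Finset ι} {i : ι} (hi : i ∈ β) :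
    colSum id β i M = (reDet M β : Quaternion ℝ) := by
  have h := colSum_id_updateCol hM (M.col i) hi
  rw [show M.updateCol i (M.col i) = M from Matrix.updateCol_eq_self M i] at h
  rw [h, ← sum_cofactor_mul_self hM hi]
  rfl

theorem reDet_empty : reDet M ∅ = 1 := by
  have h := minSum_empty (fun q => (q.re : Quaternion ℝ)) M
  rw [minSum_re] at h
  exact Quaternion.coe_injective (h.trans Quaternion.coe_one.symm)

theorem hdet_principal (hM : M.IsHermitian) (β : Finset ι) :
    hdet (principal M β) = reDet M β := by
  have hc : ∀ i : β, cdet i (principal M β) = (reDet M β : Quaternion ℝ) := fun i => by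
    rw [← colSum_id_eq_reDet hM i.2, ← cdet_principal M i.2]
  have hH : (principal M β)ᴴ = principal M β := (hM.submatrix _)
  refine hdet_eq ⟨fun i => ⟨?_, hc i⟩, fun hβ => ?_⟩
  · rw [← star_star (rdet i _), star_rdet, hH, hc, Quaternion.star_coe]
  · rw [Finset.isEmpty_coe_sort.1 hβ, reDet_empty]

/-! ### Sums of cofactors over the index sets of a given size -/

/-- The sum of the matrices of cofactors of all principal submatrices of order `s`. -/
def cofactorSum (M : Matrix ι ι (Quaternion ℝ)) (s : ℕ) : Matrix ι ι (Quaternion ℝ) :=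
  Matrix.of fun i l => ∑ β ∈ Finset.univ.powersetCard s, cofactor M β i l

theorem minorSum_eq (hM : M.IsHermitian) (s : ℕ) :
    minorSum s M = ∑ β ∈ Finset.univ.powersetCard s, reDet M β :=
  Finset.sum_congr rfl fun β _ => hdet_principal hM β

theorem cofactorSum_mul_apply (s : ℕ) (i j : ι) :
    (cofactorSum M s * M) i j
      = ∑ β ∈ (Finset.univ.powersetCard s).filter (i ∈ ·), ∑ l ∈ β, cofactor M β i l * M l j := by
  rw [Matrix.mul_apply]
  simp only [cofactorSum, Matrix.of_apply, Finset.sum_mul]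
  rw [Finset.sum_comm, Finset.sum_filter]
  refine Finset.sum_congr rfl fun β _ => ?_
  split_ifs with h
  · refine (Finset.sum_subset (Finset.subset_univ β) fun l _ hl => ?_).symm
    rw [cofactor_of_notMem_right M hl, zero_mul]
  · exact Finset.sum_eq_zero fun l _ => by rw [cofactor_of_notMem_left M h, zero_mul]

theorem cdetSum_updateCol (hM : M.IsHermitian) (s : ℕ) (i j : ι) :
    cdetSum s i (M.updateCol i (M.col j)) = (cofactorSum M s * M) i j := by
  rw [cofactorSum_mul_apply, cdetSum]
  refine Finset.sum_bij (fun β _ => β.1) (fun β _ => ?_) (fun _ _ _ _ h => Subtype.ext h)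
    (fun β hβ => ?_) (fun β _ => ?_)
  · exact Finset.mem_filter.2
      ⟨Finset.mem_powersetCard.2 ⟨Finset.subset_univ _, β.2.1⟩, β.2.2⟩
  · obtain ⟨h1, h2⟩ := Finset.mem_filter.1 hβ
    exact ⟨⟨β, (Finset.mem_powersetCard.1 h1).2, h2⟩, Finset.mem_univ _, rfl⟩
  · rw [cdet_principal _ β.2.2, colSum_id_updateCol hM _ β.2.2]
    rfl

/-- The index sets of size `s + 1` that contain `j` are the index sets of size `s` that do not,
with `j` added. -/
theorem sum_powersetCard_succ_erase {N : Type*} [AddCommMonoid N] (s : ℕ) (j : ι)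
    (f : Finset ι → N) :
    ∑ β ∈ (Finset.univ.powersetCard (s + 1)).filter (j ∈ ·), f (β.erase j)
      = ∑ β ∈ (Finset.univ.powersetCard s).filter (j ∉ ·), f β := by
  refine Finset.sum_bij' (fun β _ => β.erase j) (fun β _ => insert j β) (fun β hβ => ?_)
    (fun β hβ => ?_) (fun β hβ => ?_) (fun β hβ => ?_) (fun _ _ => rfl)
  all_goals simp only [Finset.mem_filter, Finset.mem_powersetCard_univ] at hβ ⊢
  · rw [Finset.card_erase_of_mem hβ.2, hβ.1]
    exact ⟨rfl, Finset.notMem_erase j β⟩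
  · rw [Finset.card_insert_of_notMem hβ.2, hβ.1]
    exact ⟨rfl, Finset.mem_insert_self j β⟩
  · exact Finset.insert_erase hβ.2
  · exact Finset.erase_insert hβ.2

/-- The Faddeev–LeVerrier recursion. In the entry `(i, j)` of `cofactorSum M s * M`, the index sets
that contain `j` contribute by Cramer's rule, and those that do not yield the cofactors of the sets
with `j` added. -/
theorem cofactorSum_succ (hM : M.IsHermitian) (s : ℕ) :
    cofactorSum M (s + 1)
      = minorSum s M • (1 : Matrix ι ι (Quaternion ℝ)) - cofactorSum M s * M := by
  ext1 i j
  rw [Matrix.sub_apply, Matrix.smul_apply, cofactorSum_mul_apply]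
  have hsucc : cofactorSum M (s + 1) i j
      = ∑ β ∈ (Finset.univ.powersetCard (s + 1)).filter (j ∈ ·), cofactor M β i j := by
    rw [Finset.sum_filter]
    refine Finset.sum_congr rfl fun β _ => ?_
    split_ifs with h
    · rfl
    · exact cofactor_of_notMem_right M h i
  by_cases hij : i = j
  · subst hij
    have h1 : ∀ β ∈ (Finset.univ.powersetCard s).filter (i ∈ ·),
        ∑ l ∈ β, cofactor M β i l * M l i = (reDet M β : Quaternion ℝ) := fun β hβ =>
      sum_cofactor_mul_self hM (Finset.mem_filter.1 hβ).2
    have h2 : ∀ β ∈ (Finset.univ.powersetCard (s + 1)).filter (i ∈ ·),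
        cofactor M β i i = (reDet M (β.erase i) : Quaternion ℝ) := fun β hβ =>
      cofactor_self M (Finset.mem_filter.1 hβ).2
    rw [hsucc, Finset.sum_congr rfl h1, Finset.sum_congr rfl h2,
      sum_powersetCard_succ_erase s i fun β => (reDet M β : Quaternion ℝ), Matrix.one_apply_eq,
      minorSum_eq hM, eq_sub_iff_add_eq, add_comm, Finset.sum_filter_add_sum_filter_not, ← coe_sum]
    exact Algebra.algebraMap_eq_smul_one (R := ℝ) (A := Quaternion ℝ) _
  · rw [Matrix.one_apply_ne hij, smul_zero, zero_sub, hsucc]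
    let f : Finset ι → Quaternion ℝ := fun γ =>
      if i ∈ γ then ∑ y ∈ γ, cofactor M γ i y * M y j else 0
    have h1 : ∀ β ∈ (Finset.univ.powersetCard (s + 1)).filter (j ∈ ·), cofactor M β i j
        = -f (β.erase j) := by
      intro β hβ
      have hj := (Finset.mem_filter.1 hβ).2
      by_cases hi : i ∈ β
      · rw [cofactor_eq_sum_right M hi hj hij]
        simp [f, hi, hij]
      · rw [cofactor_of_notMem_left M hi]
        simp [f, hi]
    have h2 : ∀ β ∈ Finset.univ.powersetCard s, f β ≠ 0 → j ∉ β := by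
      intro β _ hf hj
      by_cases hi : i ∈ β
      · exact hf (by simp only [f, if_pos hi, sum_cofactor_mul hM hi hj, if_neg hij])
      · exact hf (if_neg hi)
    rw [Finset.sum_congr rfl h1, Finset.sum_neg_distrib, sum_powersetCard_succ_erase s j f,
      Finset.sum_filter_of_ne h2, Finset.sum_filter]

/-- A principal minor on `β` appears on the diagonal once for each element of `β`. -/
theorem re_trace_cofactorSum_mul (hM : M.IsHermitian) (s : ℕ) :
    (cofactorSum M s * M).trace.re = s * minorSum s M := by
  have h1 : ∀ i, (cofactorSum M s * M) i i
      = ∑ β ∈ (Finset.univ.powersetCard s).filter (i ∈ ·), (reDet M β : Quaternion ℝ) := by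
    intro i
    rw [cofactorSum_mul_apply]
    exact Finset.sum_congr rfl fun β hβ => sum_cofactor_mul_self hM (Finset.mem_filter.1 hβ).2
  have h2 : ∀ i, ((cofactorSum M s * M) i i).re
      = ∑ β ∈ Finset.univ.powersetCard s, if i ∈ β then reDet M β else 0 := by
    intro i
    rw [h1, ← coe_sum, Quaternion.re_coe, Finset.sum_filter]
  simp only [Matrix.trace, Matrix.diag_apply]
  rw [re_sum, Finset.sum_congr rfl fun i _ => h2 i, Finset.sum_comm, minorSum_eq hM,
    Finset.mul_sum]
  refine Finset.sum_congr rfl fun β hβ => ?_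
  rw [← Finset.sum_filter, Finset.sum_const, nsmul_eq_mul, ← (Finset.mem_powersetCard.1 hβ).2]
  simp

theorem cofactorSum_zero : cofactorSum M 0 = 0 := by
  ext1 i j
  simp [cofactorSum, cofactor]

theorem cofactorSum_card_succ : cofactorSum M (Fintype.card ι + 1) = 0 := by
  ext1 i j
  have h : (Finset.univ : Finset ι).powersetCard (Fintype.card ι + 1) = ∅ :=
    Finset.powersetCard_eq_empty.2 (by simp)
  simp [cofactorSum, h]

theorem minorSum_zero (hM : M.IsHermitian) : minorSum 0 M = 1 := by
  rw [minorSum_eq hM]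
  simp [reDet_empty]

end Cofactors

/-! ### Rank and trace of an idempotent quaternion matrix -/

section Idempotent

variable {ι : Type*} [Fintype ι]

theorem re_trace_mul_comm {κ : Type*} [Fintype κ] (F : Matrix ι κ (Quaternion ℝ))
    (G : Matrix κ ι (Quaternion ℝ)) : (F * G).trace.re = (G * F).trace.re := by
  simp only [Matrix.trace, Matrix.diag_apply, Matrix.mul_apply, re_sum]
  rw [Finset.sum_comm]
  simp only [re_mul_comm]

theorem mulVec_eq_self_of_mem_colSpace {P : Matrix ι ι (Quaternion ℝ)} (hP : P * P = P)
    {v : ι → Quaternion ℝ} (hv : v ∈ colSpace P) : P *ᵥ v = v := by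
  induction hv using Submodule.span_induction with
  | mem v hv =>
    obtain ⟨j, rfl⟩ := hv
    funext i
    exact congrFun (congrFun hP i) j
  | zero => exact Matrix.mulVec_zero P
  | add v w _ _ hv hw => rw [Matrix.mulVec_add, hv, hw]
  | smul c v _ hv => rw [Matrix.mulVec_smul, hv]

/-- The real part of the trace of an idempotent matrix is its rank: write `P = F * G` with the
columns of `F` a basis of the column space; then `G * F = 1`. -/
theorem re_trace_eq_qrank {P : Matrix ι ι (Quaternion ℝ)} (hP : P * P = P) :
    P.trace.re = qrank P := by
  let b : Module.Basis (Fin (qrank P)) (Quaternion ℝ)ᵐᵒᵖ (colSpace P) := Module.finBasis _ _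
  let F : Matrix ι (Fin (qrank P)) (Quaternion ℝ) := Matrix.of fun i s => (b s : ι → Quaternion ℝ) i
  let G : Matrix (Fin (qrank P)) ι (Quaternion ℝ) := Matrix.of fun s j =>
    (b.repr ⟨P.col j, Submodule.subset_span ⟨j, rfl⟩⟩ s).unop
  have happ : ∀ (c : Fin (qrank P) → (Quaternion ℝ)ᵐᵒᵖ) (i : ι),
      ((∑ s, c s • b s : colSpace P) : ι → Quaternion ℝ) i = ∑ s, F i s * (c s).unop := by
    intro c i
    simp [F, Finset.sum_apply]
  have hFG : F * G = P := by
    ext1 i j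
    refine (happ (fun s => b.repr ⟨P.col j, Submodule.subset_span ⟨j, rfl⟩⟩ s) i).symm.trans ?_
    exact congrFun (congrArg Subtype.val (b.sum_repr _)) i
  have hPF : P * F = F := by
    ext1 i s
    exact congrFun (mulVec_eq_self_of_mem_colSpace hP (b s).2) i
  have hGF : G * F = 1 := by
    rw [← sub_eq_zero]
    have h0 : F * (G * F - 1) = 0 := by
      rw [Matrix.mul_sub, ← Matrix.mul_assoc, hFG, hPF, Matrix.mul_one, sub_self]
    ext1 s t
    have hlin := Fintype.linearIndependent_iff.1 b.linearIndependent
      (fun s => MulOpposite.op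
        ((G * F - (1 : Matrix (Fin (qrank P)) (Fin (qrank P)) (Quaternion ℝ))) s t)) (by
        refine Subtype.ext (funext fun i => ?_)
        exact (happ _ i).trans (congrFun (congrFun h0 i) t)) s
    exact MulOpposite.op_injective hlin
  rw [← hFG, re_trace_mul_comm, hGF, Matrix.trace_one, Fintype.card_fin, hFG]
  exact Quaternion.re_natCast _

end Idempotent

/-! ### The spectral projection of a Hermitian matrix -/

section Projection

variable {ι : Type*} [Fintype ι] [LinearOrder ι] {M P Y : Matrix ι ι (Quaternion ℝ)}

/-- For the projection `P` onto the column space of `M` along its kernel, the last nonzero sum of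
principal minors has order `rank P`, and the corresponding sum of cofactor matrices is, up to this
factor, an inverse of `M` on the column space. -/
theorem cofactorSum_mul_eq (hM : M.IsHermitian) (hY : Commute Y M) (hP : Y * M = P)
    (hPM : P * M = M) :
    minorSum (qrank P) M ≠ 0 ∧ cofactorSum M (qrank P) * M = minorSum (qrank P) M • P := by
  classical
  have hMP : M * P = M := by rw [← hP, ← mul_assoc, ← hY.eq, hP, hPM]
  have hPP : P * P = P :=
    calc P * P = Y * M * P := by rw [hP]
      _ = P := by rw [mul_assoc, hMP, hP]
  have hsucc : ∀ s, cofactorSum M (s + 1) * M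
      = minorSum s M • M - cofactorSum M s * M * M := fun s => by
    rw [cofactorSum_succ hM, sub_mul, smul_mul_assoc, one_mul]
  -- `M` can be cancelled on the right of a multiple of `M`.
  have hMY : ∀ s, cofactorSum M s * M * M * Y = cofactorSum M s * M := fun s => by
    rw [mul_assoc _ M Y, ← hY.eq, hP, mul_assoc, hMP]
  -- `q` is the last order with a nonzero sum of principal minors.
  set q := Nat.findGreatest (fun s => minorSum s M ≠ 0) (Fintype.card ι) with hq
  have hq0 : minorSum q M ≠ 0 :=
    Nat.findGreatest_spec (P := fun s => minorSum s M ≠ 0) (Nat.zero_le _)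
      (by rw [minorSum_zero hM]; exact one_ne_zero)
  have hvanish : ∀ k s, s + k = Fintype.card ι + 1 → q < s → cofactorSum M s * M = 0 := by
    intro k
    induction k with
    | zero =>
      rintro s rfl -
      rw [cofactorSum_card_succ, zero_mul]
    | succ k ih =>
      intro s hs hqs
      have h1 := ih (s + 1) (by omega) (by omega)
      have h2 : minorSum s M = 0 := by
        by_contra h
        exact Nat.findGreatest_is_greatest hqs (by omega) h
      rw [hsucc, h2, zero_smul, zero_sub, neg_eq_zero] at h1
      rw [← hMY, h1, zero_mul]
  -- The recursion at `q` now reads `minorSum q M • M = cofactorSum M q * M * M`; cancel `M`.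
  have hqle : q ≤ Fintype.card ι := Nat.findGreatest_le _
  have hT : cofactorSum M q * M = minorSum q M • P := by
    have h1 := hvanish (Fintype.card ι - q) (q + 1) (by omega) (by omega)
    rw [hsucc, sub_eq_zero] at h1
    rw [← hMY, ← h1, smul_mul_assoc, ← hY.eq, hP]
  have htr := re_trace_cofactorSum_mul hM q
  rw [hT, Matrix.trace_smul, Quaternion.re_smul, re_trace_eq_qrank hPP, smul_eq_mul,
    mul_comm] at htr
  have hqr : qrank P = q := by exact_mod_cast mul_right_cancel₀ hq0 htr
  rw [hqr]
  exact ⟨hq0, hT⟩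

theorem rdetSum_updateRow (hM : M.IsHermitian) (s : ℕ) (i j : ι) :
    rdetSum s j (M.updateRow j (M.row i)) = star (cdetSum s j (M.updateCol j (M.col i))) := by
  have h : (M.updateRow j (M.row i))ᴴ = M.updateCol j (M.col i) := by
    ext1 x y
    rw [Matrix.conjTranspose_apply]
    by_cases hy : y = j
    · subst hy
      rw [Matrix.updateRow_self, Matrix.updateCol_self]
      exact hM.apply x i
    · rw [Matrix.updateRow_ne hy, Matrix.updateCol_ne hy]
      exact hM.apply x y
  rw [rdetSum, cdetSum, star_sum, ← h]
  refine Finset.sum_congr rfl fun α _ => ?_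
  rw [← star_star (rdet _ _), star_rdet]
  rfl

theorem IsDrazinInverse.isHermitian {A X : Matrix ι ι (Quaternion ℝ)} (hA : A.IsHermitian)
    (h : IsDrazinInverse A X) : X.IsHermitian := by
  have hc : Commute A X := h.comm
  refine IsDrazinInverse.unique (A := A) (X := Xᴴ) ⟨?_, ?_, ?_⟩ h
  · rw [← (hA.pow _).eq, ← Matrix.conjTranspose_mul, ← (hc.pow_left _).eq, h.pow_mul,
      (hA.pow _).eq]
  · have := congrArg Matrix.conjTranspose h.mul_mul
    rwa [Matrix.conjTranspose_mul, Matrix.conjTranspose_mul, hA.eq, ← mul_assoc] at this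
  · have := congrArg Matrix.conjTranspose h.comm
    rw [Matrix.conjTranspose_mul, Matrix.conjTranspose_mul, hA.eq] at this
    exact this.symm

/-- `A^D A` and `A ^ index A` have the same column space. -/
theorem IsDrazinInverse.qrank_mul {A X : Matrix ι ι (Quaternion ℝ)} (h : IsDrazinInverse A X) :
    qrank (X * A) = qrank (A ^ index A) := by
  have hc : Commute A X := h.comm
  have hcol : colSpace (X * A) = colSpace (A ^ index A) := by
    refine le_antisymm (colSpace_le_iff.2 ⟨X ^ (index A + 1) * A, ?_⟩)
      (colSpace_le_iff.2 ⟨A ^ index A, ?_⟩)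
    · rw [← mul_assoc, h.eq_pow_mul_pow]
    · rw [mul_assoc, ← pow_succ', ← (hc.pow_left _).eq, h.pow_mul]
  rw [qrank, hcol, qrank]

theorem IsDrazinInverse.cofactorSum_mul {A X : Matrix ι ι (Quaternion ℝ)} (hA : A.IsHermitian)
    (h : IsDrazinInverse A X) {r : ℕ} (hr : qrank (A ^ index A) = r) :
    minorSum r (A ^ (index A + 1)) ≠ 0 ∧
      cofactorSum (A ^ (index A + 1)) r * A ^ (index A + 1)
        = minorSum r (A ^ (index A + 1)) • (X * A) := by
  have hc : Commute X A := h.comm.symm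
  have hid : IsIdempotentElem (X * A) := by
    rw [IsIdempotentElem, ← mul_assoc, h.mul_mul]
  have hP : X ^ (index A + 1) * A ^ (index A + 1) = X * A := by
    rw [← hc.mul_pow, hid.pow_succ_eq]
  have hPM : X * A * A ^ (index A + 1) = A ^ (index A + 1) := by
    rw [hc.eq, mul_assoc, (hc.pow_right _).eq, h.pow_mul, ← pow_succ']
  rw [← hr, ← h.qrank_mul]
  exact cofactorSum_mul_eq (hA.pow _) (hc.pow_pow _ _) hP hPM

end Projection

end QuatDrazin

end

theorem corollary3p2 (n k r : ℕ) (A : Matrix (Fin n) (Fin n) (Quaternion ℝ))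
    (hA : A.IsHermitian) (hk : QuatDrazin.index A = k)
    (hr₁ : QuatDrazin.qrank (A ^ (k + 1)) = r) (hr₀ : QuatDrazin.qrank (A ^ k) = r) :
    QuatDrazin.minorSum r (A ^ (k + 1)) ≠ 0 ∧
    (∀ i j : Fin n,
      (QuatDrazin.drazin A * A) i j =
        QuatDrazin.cdetSum r i ((A ^ (k + 1)).updateCol i ((A ^ (k + 1)).col j)) /
          (QuatDrazin.minorSum r (A ^ (k + 1)) : Quaternion ℝ)) ∧
    (∀ i j : Fin n,
      (A * QuatDrazin.drazin A) i j =
        QuatDrazin.rdetSum r j ((A ^ (k + 1)).updateRow j ((A ^ (k + 1)).row i)) /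
          (QuatDrazin.minorSum r (A ^ (k + 1)) : Quaternion ℝ)) := by
  subst hk
  have hX := QuatDrazin.drazin_spec A
  have hM : (A ^ (QuatDrazin.index A + 1)).IsHermitian := hA.pow _
  obtain ⟨hd, hC⟩ := hX.cofactorSum_mul hA hr₀
  have hcol : ∀ i j : Fin n, (QuatDrazin.drazin A * A) i j =
      QuatDrazin.cdetSum r i ((A ^ (QuatDrazin.index A + 1)).updateCol i
        ((A ^ (QuatDrazin.index A + 1)).col j)) /
          (QuatDrazin.minorSum r (A ^ (QuatDrazin.index A + 1)) : Quaternion ℝ) := by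
    intro i j
    have hd' : (QuatDrazin.minorSum r (A ^ (QuatDrazin.index A + 1)) : Quaternion ℝ) ≠ 0 :=
      fun h => hd (Quaternion.coe_injective h)
    rw [QuatDrazin.cdetSum_updateCol hM, hC, Matrix.smul_apply, ← Quaternion.mul_coe_eq_smul,
      mul_div_cancel_right₀ _ hd']
  refine ⟨hd, hcol, fun i j => ?_⟩
  -- `A * drazin A` is Hermitian, so the row formula is the conjugate of the column formula.
  have hstar : (A * QuatDrazin.drazin A) i j = star ((QuatDrazin.drazin A * A) j i) := by
    rw [← Matrix.conjTranspose_apply, Matrix.conjTranspose_mul, (hX.isHermitian hA).eq, hA.eq]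
  rw [hstar, hcol, QuatDrazin.rdetSum_updateRow hM, div_eq_mul_inv, div_eq_mul_inv, star_mul,
    ← Quaternion.coe_inv, Quaternion.star_coe, Quaternion.coe_commutes]
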